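/- A polytope $P\subset\mathbb{R}^d$ with nonempty interior is a \emph{parallelohedron}, or \emph{space-filling}, if $\mathbb{R}^d$ can be tiled by translates of $P$ (the translates cover $\mathbb{R}^d$ and have pairwise disjoint interiors). A \emph{zonotope} is a translate of a Minkowski sum of finitely many segments $[\mathbf 0,\mathbf v_i]$. The \emph{belt} of $P$ corresponding to a ridge $G$ of $P$ (a face of codimension $2$) is the set of all facets of $P$ parallel to $G$. A \emph{belt path} of length $n$ from a facet $F$ to a facet $F'$ is a sequence $F=F_0,\mathcal B_1,F_1,\dots,\mathcal B_n,F_n=F'$ of facets $F_i$ and belts $\mathcal B_i$ of $P$ such that $F_{i-1},F_i\in\mathcal B_i$ for $1\le i\le n$. The \emph{belt distance} between two facets is $0$ if they are opposite, and otherwise the least length of a belt path joining them ($\infty$ if there is none). The \emph{belt diameter} of $P$ is the maximum of the belt distances between two facets of $P$. \textbf{Theorem.} The belt diameter of every $5$-dimensional space-filling zonotope $P\subset\mathbb{R}^5$ does not exceed $2$. -/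

import Mathlib

open scoped Pointwise

namespace BeltZonotope

variable {E : Type*} [NormedAddCommGroup E] [NormedSpace ℝ E]

/-- The zonotope `Z(v₁, …, vₙ)`: the Minkowski sum of the segments `[0, vᵢ]`
(a single point, the origin, for `n = 0`). -/
def zonotope {n : ℕ} (v : Fin n → E) : Set E :=
  ∑ i, segment ℝ 0 (v i)

/-- A zonotope is a Minkowski sum of finitely many segments, placed anywhere in the space. -/
def IsZonotope (P : Set E) : Prop :=
  ∃ (n : ℕ) (v : Fin n → E) (c : E), P = c +ᵥ zonotope v

/-- A (convex) polytope: the convex hull of a finite set of points. -/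
def IsPolytope (P : Set E) : Prop :=
  ∃ S : Set E, S.Finite ∧ P = convexHull ℝ S

/-- The translates `t + P`, `t ∈ T`, tile the space: they cover it and have pairwise disjoint
interiors. The tiling need be neither periodic nor face-to-face. -/
def TilesBy (P : Set E) (T : Set E) : Prop :=
  (⋃ t ∈ T, (t +ᵥ P)) = Set.univ ∧
    ∀ s ∈ T, ∀ t ∈ T, s ≠ t → Disjoint (interior (s +ᵥ P)) (interior (t +ᵥ P))

/-- A parallelohedron (space-filling polytope): a full-dimensional polytope such that the space
can be tiled by translates of it. -/
def IsParallelohedron (P : Set E) : Prop :=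
  IsPolytope P ∧ (interior P).Nonempty ∧ ∃ T : Set E, TilesBy P T

/-- The dimension of (the affine hull of) a set. -/
noncomputable def dimension (P : Set E) : ℕ :=
  Module.finrank ℝ (vectorSpan ℝ P)

/-- A facet of `P`: a nonempty face, cut out by a supporting hyperplane, of codimension one. -/
def IsFacet (P F : Set E) : Prop :=
  F.Nonempty ∧ IsExposed ℝ P F ∧ dimension F + 1 = dimension P

/-- A ridge of `P`: a nonempty face, cut out by a supporting hyperplane, of codimension two. -/
def IsRidge (P G : Set E) : Prop :=
  G.Nonempty ∧ IsExposed ℝ P G ∧ dimension G + 2 = dimension P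

/-- The belt of `P` corresponding to `G`: all facets of `P` that are parallel to `G`. -/
def belt (P G : Set E) : Set (Set E) :=
  {F | IsFacet P F ∧ vectorSpan ℝ G ≤ vectorSpan ℝ F}

/-- A belt of `P` is the belt that corresponds to some ridge of `P`. -/
def IsBelt (P : Set E) (B : Set (Set E)) : Prop :=
  ∃ G, IsRidge P G ∧ B = belt P G

/-- There is a belt path `F₀, B₁, F₁, …, Bₙ, Fₙ` of length `n` on `P` with `F₀ = F`, `Fₙ = G`. -/
def HasBeltPath (P : Set E) (n : ℕ) (F G : Set E) : Prop :=
  ∃ (f : Fin (n + 1) → Set E) (B : Fin n → Set (Set E)),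
    f 0 = F ∧ f (Fin.last n) = G ∧ (∀ i, IsFacet P (f i)) ∧
      ∀ i : Fin n, IsBelt P (B i) ∧ f i.castSucc ∈ B i ∧ f i.succ ∈ B i

/-- `F` and `G` are opposite in `P`: a central symmetry of `P` takes `F` to `G`. -/
def AreOpposite (P F G : Set E) : Prop :=
  ∃ c : E, Equiv.pointReflection c '' P = P ∧ Equiv.pointReflection c '' F = G

open Classical in
/-- The belt distance between two facets: `0` for opposite facets, and otherwise the least length
of a belt path that connects them (`⊤` if there is none). -/
noncomputable def beltDist (P F G : Set E) : ℕ∞ :=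
  if AreOpposite P F G then 0 else ⨅ (n : ℕ) (_ : HasBeltPath P n F G), (n : ℕ∞)

/-- The belt diameter: the largest belt distance between two facets. -/
noncomputable def beltDiameter (P : Set E) : ℕ∞ :=
  ⨆ (F : Set E) (_ : IsFacet P F) (G : Set E) (_ : IsFacet P G), beltDist P F G

end BeltZonotope

namespace BeltZonotope

/-! ### Faces of zonotopes and their directions -/

section Zonotope

open Module Submodule

variable {E : Type*} [NormedAddCommGroup E] [NormedSpace ℝ E] {n : ℕ} {v : Fin n → E} {c : E}

/-! Directions of facets and ridges of a zonotope are exactly the hyperplanes and codimension-two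
subspaces spanned by generators, so belt paths become a matter of linear algebra
(`vectorSpan_toExposed`, `exists_toExposed_vectorSpan_eq`).

The tiling enters only through `TilesBy.not_four_classes`: modulo a spanned subspace `L` of
codimension two, no four generators are pairwise independent. At a suitable point of a ridge with
direction `L`, at least three tiles meet, and each contains a neighbourhood of the point in the
affine flat through it. Each tile also allows a small move along plus or minus each of the four
generators. By pigeonhole two tiles agree in sign on two generators, and these tiles overlap.

For two facets in dimension five, bases of their directions chosen among the generators give eight
vectors. Suppose every six of them span. Then the Gale dual is eight pairwise independent vectors
spanning a three-dimensional space; contracting one suitable vector leaves four parallel classes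
(`exists_four_classes_of_eight`), and dualizing back contradicts the belt condition
(`exists_four_classes_of_span_compl_pair`). So some six lie in a hyperplane, from which
`joinedByHyperplane` extracts a spanned hyperplane sharing a spanned three-dimensional subspace with
each facet direction. A facet with that direction is the middle of a belt path of length two. -/

theorem mem_zonotope {x : E} :
    x ∈ zonotope v ↔ ∃ w : Fin n → ℝ, (∀ i, w i ∈ Set.Icc (0 : ℝ) 1) ∧ x = ∑ i, w i • v i := by
  simp only [zonotope, Set.mem_finsetSum, segment_eq_image', zero_add, sub_zero]
  constructor
  · rintro ⟨g, hg, rfl⟩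
    choose w hw hwg using fun i => hg (Finset.mem_univ i)
    exact ⟨w, hw, Finset.sum_congr rfl fun i _ => (hwg i).symm⟩
  · rintro ⟨w, hw, rfl⟩
    exact ⟨fun i => w i • v i, fun {i} _ => ⟨w i, hw i, rfl⟩, rfl⟩

theorem mem_vadd_zonotope {x : E} :
    x ∈ c +ᵥ zonotope v ↔
      ∃ w : Fin n → ℝ, (∀ i, w i ∈ Set.Icc (0 : ℝ) 1) ∧ x = c + ∑ i, w i • v i := by
  simp only [Set.mem_vadd_set, mem_zonotope, vadd_eq_add]
  constructor
  · rintro ⟨_, ⟨w, hw, rfl⟩, rfl⟩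
    exact ⟨w, hw, rfl⟩
  · rintro ⟨w, hw, rfl⟩
    exact ⟨_, ⟨w, hw, rfl⟩, rfl⟩

theorem nonempty_vadd_zonotope : (c +ᵥ zonotope v).Nonempty :=
  ⟨_, mem_vadd_zonotope.2 ⟨0, fun i => by simp, rfl⟩⟩

theorem add_update_mem_vadd_zonotope {w : Fin n → ℝ} (hw : ∀ i, w i ∈ Set.Icc (0 : ℝ) 1)
    (i : Fin n) {r : ℝ} (hr : r ∈ Set.Icc (0 : ℝ) 1) :
    c + ∑ j, w j • v j + (r - w i) • v i ∈ c +ᵥ zonotope v := by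
  refine mem_vadd_zonotope.2 ⟨w + Pi.single i (r - w i), fun j => ?_, ?_⟩
  · by_cases h : j = i
    · subst h; simpa using hr
    · simpa [h] using hw j
  · simp [add_smul, Finset.sum_add_distrib, add_assoc, Pi.single_apply, ite_smul]

theorem coeff_of_mem_toExposed {l : E →L[ℝ] ℝ} {w : Fin n → ℝ}
    (hw : ∀ i, w i ∈ Set.Icc (0 : ℝ) 1)
    (h : c + ∑ j, w j • v j ∈ l.toExposed (c +ᵥ zonotope v)) (i : Fin n) :
    (0 < l (v i) → w i = 1) ∧ (l (v i) < 0 → w i = 0) := by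
  have key : ∀ r ∈ Set.Icc (0 : ℝ) 1, (r - w i) * l (v i) ≤ 0 := by
    intro r hr
    have := h.2 _ (add_update_mem_vadd_zonotope hw i hr)
    simpa using this
  have h0 := key 0 (by simp)
  have h1 := key 1 (by simp)
  have := (hw i).1
  have := (hw i).2
  constructor <;> intro hl <;> nlinarith

/-- On the face where `l` is maximal, a generator with `l (v i) ≠ 0` has its coefficient forced to
`0` or `1`, while one with `l (v i) = 0` has a free coefficient. -/
theorem vectorSpan_toExposed (l : E →L[ℝ] ℝ) (hne : (l.toExposed (c +ᵥ zonotope v)).Nonempty) :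
    vectorSpan ℝ (l.toExposed (c +ᵥ zonotope v)) = span ℝ (v '' {i | l (v i) = 0}) := by
  apply le_antisymm
  · rw [vectorSpan, span_le]
    rintro _ ⟨x, hx, y, hy, rfl⟩
    obtain ⟨w, hw, rfl⟩ := mem_vadd_zonotope.1 hx.1
    obtain ⟨u, hu, rfl⟩ := mem_vadd_zonotope.1 hy.1
    have : c + ∑ i, w i • v i -ᵥ (c + ∑ i, u i • v i) = ∑ i, (w i - u i) • v i := by
      simp [sub_smul]
    simp only [this]
    refine sum_mem fun i _ => ?_
    rcases lt_trichotomy (l (v i)) 0 with h | h | h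
    · rw [(coeff_of_mem_toExposed hw hx i).2 h, (coeff_of_mem_toExposed hu hy i).2 h]
      simp
    · exact smul_mem _ _ (subset_span ⟨i, h, rfl⟩)
    · rw [(coeff_of_mem_toExposed hw hx i).1 h, (coeff_of_mem_toExposed hu hy i).1 h]
      simp
  · rw [span_le]
    rintro _ ⟨i, hi, rfl⟩
    obtain ⟨x, hx⟩ := hne
    obtain ⟨w, hw, rfl⟩ := mem_vadd_zonotope.1 hx.1
    have hmem : ∀ r ∈ Set.Icc (0 : ℝ) 1, c + ∑ j, w j • v j + (r - w i) • v i ∈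
        l.toExposed (c +ᵥ zonotope v) := by
      intro r hr
      refine ⟨add_update_mem_vadd_zonotope hw i hr, fun y hy => ?_⟩
      rw [map_add, map_smul, show l (v i) = 0 from hi, smul_zero, add_zero]
      exact hx.2 y hy
    have := vsub_mem_vectorSpan ℝ (hmem 1 (by simp)) (hmem 0 (by simp))
    rw [vsub_eq_sub, add_sub_add_left_eq_sub, ← sub_smul] at this
    simpa using this

theorem vectorSpan_vadd_zonotope : vectorSpan ℝ (c +ᵥ zonotope v) = span ℝ (Set.range v) := by
  have h0 : (0 : E →L[ℝ] ℝ).toExposed (c +ᵥ zonotope v) = c +ᵥ zonotope v := by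
    ext x
    simp [ContinuousLinearMap.toExposed]
  have := vectorSpan_toExposed (c := c) (v := v) 0
    (by rw [h0]; exact nonempty_vadd_zonotope)
  simpa [h0] using this

variable [FiniteDimensional ℝ E]

/-- A functional vanishing on exactly those of the given vectors that lie in `L`. -/
theorem exists_clm_apply_eq_zero_iff_mem (v : Fin n → E) (L : Submodule ℝ E) :
    ∃ l : E →L[ℝ] ℝ, (∀ x ∈ L, l x = 0) ∧ ∀ i, l (v i) = 0 → v i ∈ L := by
  obtain ⟨f, hf⟩ := Module.exists_dual_forall_apply_ne_zero (K := ℝ)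
    (fun i : {i // v i ∉ L} => L.mkQ (v i))
    (fun i h => i.2 ((Submodule.Quotient.mk_eq_zero L).1 h))
  refine ⟨LinearMap.toContinuousLinearMap (f.comp L.mkQ), fun x hx => ?_, fun i hi => ?_⟩
  · have : L.mkQ x = 0 := (Submodule.Quotient.mk_eq_zero L).2 hx
    change f (L.mkQ x) = 0
    rw [this, map_zero]
  · by_contra h
    exact hf ⟨i, h⟩ hi

/-- Every subspace spanned by generators is the direction of an exposed face of the zonotope. -/
theorem exists_toExposed_vectorSpan_eq (hP : IsCompact (c +ᵥ zonotope v)) (I : Set (Fin n)) :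
    ∃ l : E →L[ℝ] ℝ, (∀ x ∈ span ℝ (v '' I), l x = 0) ∧
      (l.toExposed (c +ᵥ zonotope v)).Nonempty ∧
      vectorSpan ℝ (l.toExposed (c +ᵥ zonotope v)) = span ℝ (v '' I) := by
  obtain ⟨l, hl, hl'⟩ := exists_clm_apply_eq_zero_iff_mem v (span ℝ (v '' I))
  obtain ⟨x, hx, hmax⟩ := hP.exists_isMaxOn nonempty_vadd_zonotope l.continuous.continuousOn
  have hne' : (l.toExposed (c +ᵥ zonotope v)).Nonempty := ⟨x, hx, fun y hy => hmax hy⟩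
  refine ⟨l, hl, hne', ?_⟩
  rw [vectorSpan_toExposed l hne']
  apply le_antisymm
  · rw [span_le]
    rintro _ ⟨i, hi, rfl⟩
    exact hl' i hi
  · refine span_mono (Set.image_mono fun i hi => ?_)
    exact hl _ (subset_span ⟨i, hi, rfl⟩)

end Zonotope

/-! ### Local structure of tilings and the belt condition -/

section Tiling

open Module Submodule Topology

variable {E : Type*} [NormedAddCommGroup E] {P T : Set E}

theorem TilesBy.of_vadd {c : E} (h : TilesBy (c +ᵥ P) T) : TilesBy P ((· + c) '' T) := by
  have key : ∀ t : E, (t + c) +ᵥ P = t +ᵥ (c +ᵥ P) := fun t => add_vadd t c P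
  refine ⟨?_, ?_⟩
  · rw [Set.biUnion_image, ← h.1]
    simp only [key]
  · rintro _ ⟨s, hs, rfl⟩ _ ⟨t, ht, rfl⟩ hst
    simp only [key]
    exact h.2 s hs t ht fun h => hst (h ▸ rfl)

theorem TilesBy.exists_mem (h : TilesBy P T) (x : E) : ∃ t ∈ T, x ∈ t +ᵥ P := by
  obtain ⟨t, ht, hx⟩ := Set.mem_iUnion₂.1 (h.1 ▸ Set.mem_univ x)
  exact ⟨t, ht, hx⟩

theorem finite_of_bounded_of_separated [ProperSpace E] {A : Set E} (hA : Bornology.IsBounded A)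
    {r : ℝ} (hr : 0 < r) (hsep : ∀ s ∈ A, ∀ t ∈ A, dist s t < r → s = t) : A.Finite := by
  obtain ⟨Y, hY, hAY⟩ := Metric.totallyBounded_iff.1
    (hA.isCompact_closure.totallyBounded.subset subset_closure) (r / 2) (by positivity)
  have : A ⊆ ⋃ y ∈ Y, A ∩ Metric.ball y (r / 2) := by
    intro a ha
    obtain ⟨y, hy, hay⟩ := Set.mem_iUnion₂.1 (hAY ha)
    exact Set.mem_iUnion₂.2 ⟨y, hy, ha, hay⟩
  refine (hY.biUnion fun y _ => Set.Subsingleton.finite ?_).subset this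
  rintro s ⟨hs, hsy⟩ t ⟨ht, hty⟩
  refine hsep s hs t ht ((dist_triangle_right s t y).trans_lt ?_)
  rw [Metric.mem_ball] at hsy hty
  linarith

/-- A ball of radius `r` inside `P` keeps distinct translation vectors at distance at least `r`, and
boundedness of `P` confines the relevant ones to a ball. -/
theorem TilesBy.finite_meeting_ball [ProperSpace E] (h : TilesBy P T)
    (hb : Bornology.IsBounded P) (hint : (interior P).Nonempty) (x : E) :
    {t ∈ T | ((t +ᵥ P) ∩ Metric.ball x 1).Nonempty}.Finite := by
  obtain ⟨p, hp⟩ := hint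
  obtain ⟨r, hr, hpr⟩ := Metric.isOpen_iff.1 isOpen_interior p hp
  obtain ⟨M, hM⟩ := hb.exists_norm_le
  refine finite_of_bounded_of_separated (r := r) ?_ hr ?_
  · refine (Metric.isBounded_ball (x := x) (r := 1 + M + 1)).subset ?_
    rintro t ⟨-, _, ⟨q, hq, rfl⟩, hx⟩
    rw [Metric.mem_ball, dist_eq_norm] at hx ⊢
    change ‖(t +ᵥ q) - x‖ < 1 at hx
    have := hM q hq
    have h1 : t - x = (t +ᵥ q) - x - q := by rw [vadd_eq_add]; abel
    rw [h1]
    have := norm_sub_le ((t +ᵥ q) - x) q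
    linarith
  · rintro s ⟨hs, -⟩ t ⟨ht, -⟩ hst
    by_contra hne
    refine Set.disjoint_left.1 (h.2 s hs t ht hne) (show t + p ∈ _ from ?_) ?_
    · rw [interior_vadd]
      refine ⟨t - s + p, hpr ?_, show s + (t - s + p) = t + p by abel⟩
      rw [Metric.mem_ball, dist_eq_norm, add_sub_cancel_right, ← dist_eq_norm, dist_comm]
      exact hst
    · rw [interior_vadd]
      exact ⟨p, hp, rfl⟩

theorem TilesBy.finite_containing [ProperSpace E] (h : TilesBy P T)
    (hb : Bornology.IsBounded P) (hint : (interior P).Nonempty) (x : E) :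
    {t ∈ T | x ∈ t +ᵥ P}.Finite :=
  (h.finite_meeting_ball hb hint x).subset fun _ ht => ⟨ht.1, x, ht.2, by simp⟩

/-- Of the finitely many tiles meeting the unit ball, each one that misses `x` is closed, hence
misses a neighbourhood of `x`. -/
theorem TilesBy.eventually_containing [ProperSpace E] (h : TilesBy P T)
    (hc : IsCompact P) (hint : (interior P).Nonempty) (x : E) :
    ∀ᶠ y in 𝓝 x, ∀ t ∈ T, y ∈ t +ᵥ P → x ∈ t +ᵥ P := by
  have hfin := h.finite_meeting_ball hc.isBounded hint x
  have h1 : ∀ᶠ y in 𝓝 x, ∀ t ∈ {t ∈ T | ((t +ᵥ P) ∩ Metric.ball x 1).Nonempty},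
      y ∈ t +ᵥ P → x ∈ t +ᵥ P := by
    refine (Filter.eventually_all_finite hfin).2 fun t _ => ?_
    by_cases hx : x ∈ t +ᵥ P
    · exact Filter.Eventually.of_forall fun _ _ => hx
    · have : (t +ᵥ P)ᶜ ∈ 𝓝 x := (hc.vadd t).isClosed.isOpen_compl.mem_nhds hx
      filter_upwards [this] with y hy hy' using absurd hy' hy
  filter_upwards [h1, Metric.ball_mem_nhds x one_pos] with y hy hyb t ht hyt
  exact hy t ⟨ht, y, hyt, hyb⟩ hyt

variable [NormedSpace ℝ E]

theorem exists_forall_add_mem_intrinsicInterior {G : Set E} {x : E}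
    (hx : x ∈ intrinsicInterior ℝ G) :
    ∃ δ > 0, ∀ u ∈ vectorSpan ℝ G, ‖u‖ < δ → x + u ∈ intrinsicInterior ℝ G := by
  obtain ⟨y, hy, rfl⟩ := mem_intrinsicInterior.1 hx
  obtain ⟨δ, hδ, hball⟩ := Metric.isOpen_iff.1 isOpen_interior y hy
  refine ⟨δ, hδ, fun u hu hlt => ?_⟩
  have hmem : (y : E) + u ∈ affineSpan ℝ G := by
    rw [add_comm]
    refine AffineSubspace.vadd_mem_of_mem_direction ?_ y.2
    rwa [direction_affineSpan]
  refine mem_intrinsicInterior.2 ⟨⟨y + u, hmem⟩, hball ?_, rfl⟩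
  rw [Metric.mem_ball, Subtype.dist_eq, dist_eq_norm]
  simpa using hlt

/-- At some point of a convex set `G`, every tile containing the point contains a neighbourhood of
it in the affine hull of `G`. -/
theorem TilesBy.exists_mem_forall_add_mem [FiniteDimensional ℝ E] (h : TilesBy P T)
    (hc : IsCompact P) (hint : (interior P).Nonempty) {G : Set E} (hG : Convex ℝ G)
    (hne : G.Nonempty) :
    ∃ x ∈ G, ∃ δ > 0, ∀ t ∈ T, x ∈ t +ᵥ P → ∀ u ∈ vectorSpan ℝ G, ‖u‖ < δ → x + u ∈ t +ᵥ P := by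
  have : ProperSpace E := FiniteDimensional.proper ℝ E
  let N : E → Set E := fun x => {t ∈ T | x ∈ t +ᵥ P}
  have hN : ∀ x, (N x).Finite := h.finite_containing hc.isBounded hint
  -- Take a relative interior point lying in the fewest tiles. Nearby points lie in no new tiles, so
  -- by minimality nearby points of the flat lie in the same tiles.
  obtain ⟨x, hx, hmin⟩ := WellFounded.has_min (InvImage.wf (fun x => (N x).ncard) wellFounded_lt)
    _ (hne.intrinsicInterior hG)
  obtain ⟨δ₁, hδ₁, hδG⟩ := exists_forall_add_mem_intrinsicInterior hx
  obtain ⟨δ₂, hδ₂, hball⟩ := Metric.eventually_nhds_iff.1 (h.eventually_containing hc hint x)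
  refine ⟨x, intrinsicInterior_subset hx, min δ₁ δ₂, lt_min hδ₁ hδ₂, fun t ht hxt u hu hlt => ?_⟩
  have hsub : N (x + u) ⊆ N x := fun s hs =>
    ⟨hs.1, hball (by simpa using hlt.trans_le (min_le_right _ _)) s hs.1 hs.2⟩
  have hcard := not_lt.1 (hmin _ (hδG u hu (hlt.trans_le (min_le_left _ _))))
  have heq := Set.eq_of_subset_of_ncard_le hsub hcard (hN x)
  have : t ∈ N (x + u) := heq ▸ ⟨ht, hxt⟩
  exact this.2

/-- A coefficient below `1` can be raised, and a coefficient equal to `1` can be lowered. The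
boolean records the sign of the move. -/
theorem exists_add_smul_mem_of_mem_vadd_zonotope {n : ℕ} {v : Fin n → E} {c x : E}
    (hx : x ∈ c +ᵥ zonotope v) (i : Fin n) :
    ∃ b : Bool, ∃ ε : ℝ, 0 < ε ∧ x + (bif b then ε else -ε) • v i ∈ c +ᵥ zonotope v := by
  obtain ⟨w, hw, rfl⟩ := mem_vadd_zonotope.1 hx
  by_cases h : w i < 1
  · exact ⟨true, 1 - w i, by linarith, add_update_mem_vadd_zonotope hw i (by simp)⟩
  · refine ⟨false, w i, by linarith, ?_⟩
    have := add_update_mem_vadd_zonotope (c := c) (v := v) hw i (r := 0) (by simp)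
    simpa using this

theorem exists_pair_agreeing_twice (f : Fin 3 → Fin 4 → Bool) :
    ∃ p q a b, p ≠ q ∧ a ≠ b ∧ f p a = f q a ∧ f p b = f q b := by
  -- Two of three booleans agree; `r` is the index left out. Four columns and three values of `r`
  -- make two columns share the agreeing pair.
  have : ∀ a, ∃ r : Fin 3, f (r + 1) a = f (r + 2) a := by
    intro a
    by_contra! h
    have h0 := h 0
    have h1 := h 1
    have h2 := h 2
    simp at h0 h1 h2
    cases h3 : f 0 a <;> cases h4 : f 1 a <;> cases h5 : f 2 a <;> simp_all
  choose r hr using this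
  obtain ⟨a, b, hab, hrab⟩ := Fintype.exists_ne_map_eq_of_card_lt r (by simp)
  exact ⟨r a + 1, r a + 2, a, b, by simp, hab, hr a, hrab ▸ hr b⟩

/-- Convex sets containing a neighbourhood of `x` in `x + L` and two further points independent
modulo `L` have interior points in common. -/
theorem interior_inter_nonempty [FiniteDimensional ℝ E] {A B : Set E} (hA : Convex ℝ A)
    (hB : Convex ℝ B) {L : Submodule ℝ E} {x y z : E} {δ : ℝ} (hδ : 0 < δ)
    (hLA : ∀ u ∈ L, ‖u‖ < δ → x + u ∈ A) (hLB : ∀ u ∈ L, ‖u‖ < δ → x + u ∈ B)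
    (hyA : x + y ∈ A) (hyB : x + y ∈ B) (hzA : x + z ∈ A) (hzB : x + z ∈ B)
    (htop : L ⊔ span ℝ {y, z} = ⊤) : (interior A ∩ interior B).Nonempty := by
  -- The convex hull of a disc in `x + L` and the two extra points is full-dimensional and lies in
  -- both sets.
  let S : Set E := (x + ·) '' ({u | u ∈ L ∧ ‖u‖ < δ} ∪ {y, z})
  have hSsub : ∀ {C : Set E}, Convex ℝ C → (∀ u ∈ L, ‖u‖ < δ → x + u ∈ C) → x + y ∈ C →
      x + z ∈ C → interior (convexHull ℝ S) ⊆ interior C := by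
    intro C hC hL hy hz
    refine interior_mono (convexHull_min ?_ hC)
    rintro _ ⟨u, ⟨hu, hlt⟩ | rfl | rfl, rfl⟩
    exacts [hL u hu hlt, hy, hz]
  have hxS : x ∈ S := ⟨0, Or.inl ⟨L.zero_mem, by simpa using hδ⟩, add_zero x⟩
  have hmem : ∀ u, x + u ∈ S → u ∈ vectorSpan ℝ S := fun u hu => by
    simpa using vsub_mem_vectorSpan ℝ hu hxS
  have hspan : vectorSpan ℝ S = ⊤ := by
    rw [eq_top_iff, ← htop]
    refine sup_le (fun u hu => ?_) (span_le.2 ?_)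
    · have hpos : 0 < δ / (‖u‖ + 1) := by positivity
      have : (δ / (‖u‖ + 1)) • u ∈ vectorSpan ℝ S := by
        refine hmem _ ⟨_, Or.inl ⟨L.smul_mem _ hu, ?_⟩, rfl⟩
        rw [norm_smul, Real.norm_of_nonneg hpos.le, div_mul_eq_mul_div, div_lt_iff₀ (by positivity)]
        nlinarith
      exact (Submodule.smul_mem_iff _ hpos.ne').1 this
    · rintro _ (rfl | rfl)
      · exact hmem _ ⟨_, Or.inr (by simp), rfl⟩
      · exact hmem _ ⟨_, Or.inr (by simp), rfl⟩
  have hne : (interior (convexHull ℝ S)).Nonempty :=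
    interior_convexHull_nonempty_iff_affineSpan_eq_top.2
      ((AffineSubspace.affineSpan_eq_top_iff_vectorSpan_eq_top_of_nonempty ℝ E E ⟨x, hxS⟩).2 hspan)
  exact hne.mono (Set.subset_inter (hSsub hA hLA hyA hzA) (hSsub hB hLB hyB hzB))

/-- At a point of a codimension-two face of a tile there are at least two other tiles. -/
theorem TilesBy.exists_two_other_tiles [FiniteDimensional ℝ E] (h : TilesBy P T)
    (hc : IsCompact P) (hconv : Convex ℝ P) (hint : (interior P).Nonempty) {t₀ : E} (ht₀ : t₀ ∈ T)
    {l : E →L[ℝ] ℝ} {x : E} (hx : x ∈ l.toExposed (t₀ +ᵥ P))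
    (hdim : finrank ℝ (vectorSpan ℝ (l.toExposed (t₀ +ᵥ P))) + 2 = finrank ℝ E) :
    ∃ t₁ ∈ T, ∃ t₂ ∈ T, x ∈ t₁ +ᵥ P ∧ x ∈ t₂ +ᵥ P ∧ t₁ ≠ t₀ ∧ t₂ ≠ t₀ ∧ t₁ ≠ t₂ := by
  have : ProperSpace E := FiniteDimensional.proper ℝ E
  by_contra! hcon
  set L := vectorSpan ℝ (l.toExposed (t₀ +ᵥ P)) with hL
  -- Moving from `x` along `w` stays in the supporting hyperplane but leaves the face, hence leaves
  -- the tile `t₀ +ᵥ P` on both sides.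
  obtain ⟨w, hw, hwL⟩ : ∃ w, l w = 0 ∧ w ∉ L := by
    by_contra! hle
    have h1 := finrank_mono (show LinearMap.ker (l : E →ₗ[ℝ] ℝ) ≤ L from hle)
    have h2 := (l : E →ₗ[ℝ] ℝ).finrank_range_add_finrank_ker
    have h3 := (LinearMap.range (l : E →ₗ[ℝ] ℝ)).finrank_le
    rw [finrank_self] at h3
    omega
  have hev := (h.eventually_containing hc hint x).eventually_nhds
  -- If only one other tile contains `x`, it must fill a neighbourhood of `x + r • w`. Using `r` and
  -- `-r`, convexity puts `x` in its interior, so it overlaps `t₀ +ᵥ P`.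
  have key : ∀ᶠ r : ℝ in 𝓝 0, r ≠ 0 → ∃ t ∈ T, t ≠ t₀ ∧ x ∈ t +ᵥ P ∧
      x + r • w ∈ interior (t +ᵥ P) := by
    have hlim : Filter.Tendsto (fun r : ℝ => x + r • w) (𝓝 0) (𝓝 x) := by
      have : Continuous fun r : ℝ => x + r • w := by fun_prop
      simpa using this.tendsto 0
    filter_upwards [hlim.eventually hev] with r hr hr0
    have hnot : x + r • w ∉ t₀ +ᵥ P := by
      intro hmem
      have hG : x + r • w ∈ l.toExposed (t₀ +ᵥ P) :=
        ⟨hmem, fun y hy => by simpa [hw] using hx.2 y hy⟩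
      have := vsub_mem_vectorSpan ℝ hG hx
      rw [vsub_eq_sub, add_sub_cancel_left] at this
      exact hwL ((Submodule.smul_mem_iff _ hr0).1 this)
    have hcompl : (t₀ +ᵥ P)ᶜ ∈ 𝓝 (x + r • w) := (hc.vadd t₀).isClosed.isOpen_compl.mem_nhds hnot
    obtain ⟨t, ht, hrt⟩ := h.exists_mem (x + r • w)
    have htne : t ≠ t₀ := fun h => hnot (h ▸ hrt)
    have hxt := hr.self_of_nhds t ht hrt
    refine ⟨t, ht, htne, hxt, mem_interior_iff_mem_nhds.2 ?_⟩
    filter_upwards [hr, hcompl] with y hy hy₀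
    obtain ⟨s, hs, hys⟩ := h.exists_mem y
    have hsne : s ≠ t₀ := fun h => hy₀ (h ▸ hys)
    rwa [hcon t ht s hs hxt (hy s hs hys) htne hsne]
  obtain ⟨δ, hδ, hball⟩ := Metric.eventually_nhds_iff.1 key
  obtain ⟨t, ht, hne, hxt, h1⟩ := hball (y := δ / 2)
    (by rw [dist_zero_right, Real.norm_of_nonneg (by positivity)]; linarith) (by positivity)
  obtain ⟨s, hs, hsne, hxs, h2⟩ := hball (y := -(δ / 2))
    (by rw [dist_zero_right, norm_neg, Real.norm_of_nonneg (by positivity)]; linarith)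
    (neg_ne_zero.2 (by positivity))
  obtain rfl := hcon s hs t ht hxs hxt hsne hne
  have hxint : x ∈ interior (s +ᵥ P) := by
    have := (hconv.vadd s).interior h1 h2 (by norm_num : (0 : ℝ) ≤ 1 / 2)
      (by norm_num : (0 : ℝ) ≤ 1 / 2) (by norm_num)
    convert this using 1
    module
  have hxcl : x ∈ closure (interior (t₀ +ᵥ P)) := by
    rw [(hconv.vadd t₀).closure_interior_eq_closure_of_nonempty_interior
      (by rw [interior_vadd]; exact hint.vadd_set)]
    exact subset_closure hx.1
  obtain ⟨y, hy, hy'⟩ := mem_closure_iff.1 hxcl _ isOpen_interior hxint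
  exact Set.disjoint_left.1 (h.2 s hs t₀ ht₀ hsne) hy hy'

/-- Modulo a codimension-two subspace spanned by generators, the generators of a space-filling
zonotope have at most three directions: every belt has at most six facets. -/
theorem TilesBy.not_four_classes [FiniteDimensional ℝ E] {n : ℕ} {v : Fin n → E}
    (h : TilesBy (zonotope v) T) (hc : IsCompact (zonotope v)) (hconv : Convex ℝ (zonotope v))
    (hint : (interior (zonotope v)).Nonempty) {I : Set (Fin n)}
    (hI : finrank ℝ (span ℝ (v '' I)) + 2 = finrank ℝ E) (k : Fin 4 → Fin n) :
    ∃ a b, a ≠ b ∧ span ℝ (v '' I) ⊔ span ℝ {v (k a), v (k b)} ≠ ⊤ := by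
  by_contra! hcon
  obtain ⟨t₀, ht₀, -⟩ := h.exists_mem 0
  obtain ⟨l, -, hne, hspan⟩ := exists_toExposed_vectorSpan_eq (hc.vadd t₀) I
  obtain ⟨x, hx, δ, hδ, hflat⟩ := h.exists_mem_forall_add_mem hc hint
    ((ContinuousLinearMap.toExposed.isExposed (l := l)).convex (hconv.vadd t₀)) hne
  obtain ⟨t₁, ht₁, t₂, ht₂, hxt₁, hxt₂, h10, h20, h12⟩ :=
    h.exists_two_other_tiles hc hconv hint ht₀ hx (by rw [hspan, hI])
  rw [hspan] at hflat
  let t : Fin 3 → E := ![t₀, t₁, t₂]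
  have htT : ∀ p, t p ∈ T := by
    intro p; fin_cases p <;> assumption
  have hxt : ∀ p, x ∈ t p +ᵥ zonotope v := by
    intro p
    fin_cases p
    exacts [hx.1, hxt₁, hxt₂]
  have htinj : Function.Injective t := by
    intro p q hpq
    fin_cases p <;> fin_cases q <;> simp_all [t, eq_comm]
  choose f ε hε hf using fun p a => exists_add_smul_mem_of_mem_vadd_zonotope (hxt p) (k a)
  obtain ⟨p, q, a, b, hpq, hab, ha, hb⟩ := exists_pair_agreeing_twice f
  -- By convexity shorter moves are allowed too, so the two tiles that agree in sign share the move
  -- of length parameter `min (ε p a) (ε q a)`.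
  have shrink : ∀ p a (r : ℝ), 0 < r → r ≤ ε p a →
      x + (bif f p a then r else -r) • v (k a) ∈ t p +ᵥ zonotope v := by
    intro p a r hr hle
    have := (hconv.vadd (t p)).add_smul_sub_mem (hxt p) (hf p a) (t := r / ε p a)
      ⟨(div_pos hr (hε p a)).le, (div_le_one (hε p a)).2 hle⟩
    have hne := (hε p a).ne'
    convert this using 1
    cases f p a <;> simp [smul_smul, hne]
  have hmin : ∀ a, 0 < min (ε p a) (ε q a) := fun a => lt_min (hε p a) (hε q a)
  have hsp : ∀ (b : Bool) {r : ℝ} (y : E), 0 < r →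
      span ℝ {(bif b then r else -r) • y} = span ℝ {y} := by
    intro b r y hr
    refine span_singleton_smul_eq (IsUnit.mk0 _ ?_) y
    cases b
    · exact neg_ne_zero.2 hr.ne'
    · exact hr.ne'
  have hA := shrink p a _ (hmin a) (min_le_left _ _)
  have hA' := shrink q a _ (hmin a) (min_le_right _ _)
  have hB := shrink p b _ (hmin b) (min_le_left _ _)
  have hB' := shrink q b _ (hmin b) (min_le_right _ _)
  rw [← ha] at hA'
  rw [← hb] at hB'
  refine Set.not_disjoint_iff_nonempty_inter.2 (interior_inter_nonempty (hconv.vadd (t p))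
    (hconv.vadd (t q)) hδ (hflat _ (htT p) (hxt p)) (hflat _ (htT q) (hxt q)) hA hA' hB hB' ?_)
    (h.2 _ (htT p) _ (htT q) (htinj.ne hpq))
  rw [← hcon a b hab, span_insert, span_insert, hsp _ _ (hmin a), hsp _ _ (hmin b)]

end Tiling

open Module Submodule

/-! ### Eight vectors in a three-dimensional space -/

section Pigeonhole

variable {X ι : Type*} [AddCommGroup X] [Module ℝ X]

theorem finrank_span_pair_eq_two {x y : X} (h : LinearIndependent ℝ ![x, y]) :
    finrank ℝ (span ℝ {x, y}) = 2 := by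
  have := finrank_span_eq_card h
  rwa [Matrix.range_cons_cons_empty, Fintype.card_fin] at this

theorem eq_top_of_lt_of_finrank [FiniteDimensional ℝ X] (hX : finrank ℝ X = 3) {Y Z : Submodule ℝ X}
    (hY : finrank ℝ Y = 2) (hYZ : Y < Z) : Z = ⊤ := by
  have := finrank_lt_finrank_of_lt hYZ
  have := Z.finrank_le
  exact eq_top_of_finrank_eq (by omega)

/-- Eight pairwise independent vectors spanning a three-dimensional space have a rank-two
contraction by one of them with at least four parallel classes. -/
theorem exists_four_classes_of_eight [FiniteDimensional ℝ X] [Fintype ι] [DecidableEq ι] (hι : Fintype.card ι = 8)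
    (hX : finrank ℝ X = 3) (x : ι → X) (hx : span ℝ (Set.range x) = ⊤)
    (hli : ∀ i j, i ≠ j → LinearIndependent ℝ ![x i, x j]) :
    ∃ (p : ι) (S : Finset ι), S.card = 4 ∧ p ∉ S ∧
      ∀ i ∈ S, ∀ j ∈ S, i ≠ j → span ℝ {x p, x i, x j} = ⊤ := by
  classical
  obtain ⟨p⟩ : Nonempty ι := Fintype.card_pos_iff.1 (by omega)
  let Y : ι → Submodule ℝ X := fun i => span ℝ {x p, x i}
  let O : Finset ι := Finset.univ.erase p
  have hO : O.card = 7 := by simp [O, hι]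
  -- Four distinct planes through `x p` are four parallel classes after contracting `x p`.
  by_cases hc : 4 ≤ (O.image Y).card
  · obtain ⟨t, ht, ht4⟩ := Finset.exists_subset_card_eq hc
    obtain ⟨S, hSO, hinj, hSt⟩ := Finset.exists_subset_injOn_image_eq_of_surjOn O (t := t)
      (f := Y) (by
        intro y hy
        simpa using ht hy)
    have hS4 : S.card = 4 := by rw [← ht4, ← hSt, Finset.card_image_of_injOn hinj]
    have hSp : p ∉ S := fun h => by simpa [O] using hSO h
    refine ⟨p, S, hS4, hSp, fun i hi j hj hij => ?_⟩
    have h2 : ∀ k ∈ S, finrank ℝ (Y k) = 2 := fun k hk =>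
      finrank_span_pair_eq_two (hli _ _ (ne_of_mem_of_not_mem hk hSp).symm)
    have hij' : Y i ≤ span ℝ {x p, x i, x j} :=
      span_mono (Set.insert_subset_insert (Set.subset_insert_iff.2 (by simp)))
    have hji' : Y j ≤ span ℝ {x p, x i, x j} :=
      span_mono (Set.insert_subset_insert (Set.subset_insert _ _))
    refine eq_top_of_lt_of_finrank hX (h2 i hi) (lt_of_le_of_ne hij' fun h => hij ?_)
    exact hinj hi hj (eq_of_le_of_finrank_eq (h ▸ hji') ((h2 j hj).trans (h2 i hi).symm)).symm
  -- At most three planes hold the other seven vectors, so one plane `Z` holds three of them and `x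
  -- p` as well. Contracting any `x q` outside `Z` keeps these four nonparallel.
  · obtain ⟨Z, -, hZ⟩ := Finset.exists_lt_card_fiber_of_mul_lt_card_of_maps_to
      (s := O) (t := O.image Y) (f := Y) (n := 2)
      (fun i hi => Finset.mem_image_of_mem _ hi) (by omega)
    obtain ⟨U, hU, hU3⟩ := Finset.exists_subset_card_eq (Nat.succ_le_of_lt hZ)
    have hUp : ∀ i ∈ U, i ≠ p ∧ Y i = Z := by
      intro i hi
      have := hU hi
      simp [O] at this
      exact this
    obtain ⟨i₀, hi₀⟩ : U.Nonempty := Finset.card_pos.1 (by omega)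
    have hZ2 : finrank ℝ Z = 2 := by
      rw [← (hUp i₀ hi₀).2]
      exact finrank_span_pair_eq_two (hli _ _ (hUp i₀ hi₀).1.symm)
    obtain ⟨q, hq⟩ : ∃ q, x q ∉ Z := by
      by_contra! h
      have : Z = ⊤ := top_le_iff.1 (hx ▸ span_le.2 (by rintro _ ⟨i, rfl⟩; exact h i))
      rw [this, finrank_top] at hZ2
      omega
    have hxp : x p ∈ Z := (hUp i₀ hi₀).2 ▸ subset_span (by simp)
    have hxU : ∀ i ∈ insert p U, x i ∈ Z := by
      intro i hi
      rcases Finset.mem_insert.1 hi with rfl | hi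
      · exact hxp
      · exact (hUp i hi).2 ▸ subset_span (by simp)
    refine ⟨q, insert p U, ?_, fun h => hq (hxU q h), fun i hi j hj hij => ?_⟩
    · rw [Finset.card_insert_of_notMem (fun h => (hUp p h).1 rfl), hU3]
    · have hle : span ℝ {x i, x j} ≤ Z := span_le.2 (by
        rintro _ (rfl | rfl)
        exacts [hxU i hi, hxU j hj])
      have heq := eq_of_le_of_finrank_eq hle
        (by rw [hZ2]; exact finrank_span_pair_eq_two (hli _ _ hij))
      refine eq_top_of_lt_of_finrank hX hZ2 (lt_of_le_of_ne ?_ fun h => hq ?_)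
      · rw [← heq]
        exact span_mono (Set.subset_insert _ _)
      · rw [h]; exact subset_span (by simp)

end Pigeonhole

/-! ### Gale duality and spanned hyperplanes in dimension five -/

section Spanned

variable {E ι : Type*} [AddCommGroup E] [Module ℝ E]

theorem span_range_dual_eq_top [FiniteDimensional ℝ E] (φ : ι → Dual ℝ E)
    (h : ∀ z, (∀ i, φ i z = 0) → z = 0) : span ℝ (Set.range φ) = ⊤ := by
  refine span_eq_top_of_ne_zero fun z hz => ?_
  by_contra! h'
  exact hz (h z fun i => h' _ ⟨i, rfl⟩)

theorem finrank_span_image_of_linearIndepOn {e : ι → E} {D : Finset ι}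
    (h : LinearIndepOn ℝ e D) : finrank ℝ (span ℝ (e '' D)) = D.card := by
  have := finrank_span_eq_card h
  rwa [← Nat.card_eq_fintype_card, Nat.card_coe_set_eq, Set.ncard_coe_finset,
    ← Set.image_eq_range] at this

theorem finrank_span_image_compl {v : ι → E} {m : ℕ} {a : Fin m → ι}
    (ha : LinearIndependent ℝ (v ∘ a)) (s : Finset (Fin m)) :
    finrank ℝ (span ℝ (v '' (a '' ((s : Set (Fin m))ᶜ)))) = m - s.card := by
  rw [← Set.image_comp, ← Finset.coe_compl,
    finrank_span_image_of_linearIndepOn (ha.linearIndepOn _), Finset.card_compl, Fintype.card_fin]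

/-- Two of the hyperplanes spanned by a family of vectors, `span (v '' I)` and `span (v '' J)`,
that are joined by a third one meeting each of them in a spanned subspace of codimension two. -/
def JoinedByHyperplane (v : ι → E) (I J : Set ι) : Prop :=
  ∃ I' J' K : Set ι, finrank ℝ (span ℝ (v '' I')) = 3 ∧ finrank ℝ (span ℝ (v '' J')) = 3 ∧
    finrank ℝ (span ℝ (v '' K)) = 4 ∧ span ℝ (v '' I') ≤ span ℝ (v '' I) ∧
    span ℝ (v '' J') ≤ span ℝ (v '' J) ∧ span ℝ (v '' I') ≤ span ℝ (v '' K) ∧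
    span ℝ (v '' J') ≤ span ℝ (v '' K)

theorem JoinedByHyperplane.symm {v : ι → E} {I J : Set ι} (h : JoinedByHyperplane v I J) :
    JoinedByHyperplane v J I := by
  obtain ⟨I', J', K, h1, h2, h3, h4, h5, h6, h7⟩ := h
  exact ⟨J', I', K, h2, h1, h3, h5, h4, h7, h6⟩

variable [FiniteDimensional ℝ E]

/-- Eight vectors spanning a five-dimensional space, such that any six of them still span it, have
a rank-two contraction with four parallel classes. -/
theorem exists_four_classes_of_span_compl_pair [Fintype ι] [DecidableEq ι]
    (hι : Fintype.card ι = 8) (hE : finrank ℝ E = 5) (e : ι → E)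
    (he : ∀ s t, s ≠ t → span ℝ (e '' {s, t}ᶜ) = ⊤) :
    ∃ C S : Finset ι, S.card = 4 ∧ finrank ℝ (span ℝ (e '' C)) = 3 ∧
      ∀ k ∈ S, ∀ l ∈ S, k ≠ l → span ℝ (e '' C) ⊔ span ℝ {e k, e l} = ⊤ := by
  classical
  let Λ := Finsupp.linearCombination ℝ e
  -- The Gale dual: `R` is the space of linear relations, of dimension 8 - 5 = 3, and the coordinate
  -- functionals `φ s` are the dual vectors.
  let R : Submodule ℝ (ι →₀ ℝ) := LinearMap.ker Λ
  let φ : ι → Dual ℝ R := fun s => (Finsupp.lapply s).comp R.subtype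
  obtain ⟨s₀, t₀, hst₀⟩ := Fintype.exists_pair_of_one_lt_card (α := ι) (by omega)
  have hR : finrank ℝ R = 3 := by
    have h1 := Λ.finrank_range_add_finrank_ker
    have h2 : LinearMap.range Λ = ⊤ := by
      rw [Finsupp.range_linearCombination, eq_top_iff, ← he _ _ hst₀]
      exact span_mono (Set.image_subset_range _ _)
    rw [h2, finrank_top, hE, finrank_finsupp_self, hι] at h1
    change finrank ℝ (LinearMap.ker Λ) = 3
    omega
  have hD : finrank ℝ (Dual ℝ R) = 3 := (Subspace.dual_finrank_eq (K := ℝ) (V := R)).trans hR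
  have hspan : span ℝ (Set.range φ) = ⊤ := by
    exact span_range_dual_eq_top (E := R) φ fun z hz => Subtype.ext (Finsupp.ext hz)
  -- Since `e s` is a combination of the vectors other than `e s` and `e t`, some relation involves
  -- `s` but not `t`; this makes `φ s` and `φ t` independent.
  have hrel : ∀ s t, s ≠ t → ∃ g : R, φ s g = 1 ∧ φ t g = 0 := by
    intro s t hst
    have hs : e s ∈ span ℝ (e '' {s, t}ᶜ) := he s t hst ▸ mem_top
    obtain ⟨c, hc, hsum⟩ := (Finsupp.mem_span_image_iff_linearCombination ℝ).1 hs
    have hcs : c s = 0 := by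
      by_contra h
      exact hc (Finsupp.mem_support_iff.2 h) (by simp)
    have hct : c t = 0 := by
      by_contra h
      exact hc (Finsupp.mem_support_iff.2 h) (by simp)
    refine ⟨⟨Finsupp.single s 1 - c, ?_⟩, ?_, ?_⟩
    · rw [LinearMap.mem_ker, map_sub, Finsupp.linearCombination_single, one_smul, hsum, sub_self]
    · simp [φ, hcs]
    · simp [φ, hct, hst.symm]
  have hli : ∀ s t, s ≠ t → LinearIndependent ℝ ![φ s, φ t] := by
    intro s t hst
    obtain ⟨g, hg, hg'⟩ := hrel s t hst
    obtain ⟨g₂, hg₂, hg₂'⟩ := hrel t s hst.symm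
    refine LinearIndependent.pair_iff.2 fun a b hab => ⟨?_, ?_⟩
    · simpa [hg, hg'] using LinearMap.congr_fun hab g
    · simpa [hg₂, hg₂'] using LinearMap.congr_fun hab g₂
  obtain ⟨p, S, hS, hpS, htop⟩ := exists_four_classes_of_eight hι hD φ hspan hli
  have hC : (insert p S)ᶜ.card = 3 := by
    rw [Finset.card_compl, Finset.card_insert_of_notMem hpS, hS, hι]
  have hind : ∀ k ∈ S, ∀ l ∈ S, k ≠ l →
      LinearIndepOn ℝ e (insert k (insert l ((insert p S)ᶜ : Finset ι)) : Finset ι) := by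
    intro k hk l hl hkl
    obtain ⟨i, j, hij, hS'⟩ : ∃ i j, i ≠ j ∧ (S.erase k).erase l = {i, j} := by
      refine Finset.card_eq_two.1 ?_
      rw [Finset.card_erase_of_mem (Finset.mem_erase.2 ⟨hkl.symm, hl⟩),
        Finset.card_erase_of_mem hk, hS]
    have hi : i ∈ (S.erase k).erase l := by simp [hS']
    have hj : j ∈ (S.erase k).erase l := by simp [hS']
    simp only [Finset.mem_erase] at hi hj
    refine linearIndepOn_iff.2 fun c hc hc0 => ?_
    have hvan : ∀ m, m ∉ insert k (insert l ((insert p S)ᶜ : Finset ι)) → c m = 0 := by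
      intro m hm
      by_contra h
      exact hm (hc (Finsupp.mem_support_iff.2 h))
    let g : R := ⟨c, hc0⟩
    -- A relation supported off `p`, `i`, `j` is killed by three functionals spanning the dual of
    -- `R`, so it vanishes: complements of dual bases are bases.
    have hle : span ℝ {φ p, φ i, φ j} ≤ LinearMap.ker (Dual.eval ℝ R g) := by
      refine span_le.2 ?_
      rintro _ (rfl | rfl | rfl)
      · refine hvan p ?_
        simp only [Finset.mem_insert, Finset.mem_compl, not_or]
        exact ⟨fun h => hpS (h ▸ hk), fun h => hpS (h ▸ hl), by simp⟩
      · refine hvan i ?_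
        simp only [Finset.mem_insert, Finset.mem_compl, not_or]
        exact ⟨hi.2.1, hi.1, by simp [hi.2.2]⟩
      · refine hvan j ?_
        simp only [Finset.mem_insert, Finset.mem_compl, not_or]
        exact ⟨hj.2.1, hj.1, by simp [hj.2.2]⟩
    rw [htop i hi.2.2 j hj.2.2 hij] at hle
    ext m
    exact hle (mem_top (x := φ m))
  have hcard : ∀ k ∈ S, ∀ l ∈ S, k ≠ l →
      (insert k (insert l ((insert p S)ᶜ : Finset ι))).card = 5 := by
    intro k hk l hl hkl
    rw [Finset.card_insert_of_notMem (by simp [hkl, hk]),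
      Finset.card_insert_of_notMem (by simp [hl]), hC]
  refine ⟨(insert p S)ᶜ, S, hS, ?_, fun k hk l hl hkl => ?_⟩
  · obtain ⟨k, hk, l, hl, hkl⟩ := Finset.one_lt_card.1 (by omega : 1 < S.card)
    rw [finrank_span_image_of_linearIndepOn ((hind k hk l hl hkl).mono (by
      intro x hx
      simp only [Finset.coe_insert, Set.mem_insert_iff]
      exact Or.inr (Or.inr hx))), hC]
  · have := finrank_span_image_of_linearIndepOn (hind k hk l hl hkl)
    rw [hcard k hk l hl hkl, ← hE] at this
    rw [← span_union, ← eq_top_of_finrank_eq this]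
    congr 1
    ext x
    simp only [Finset.coe_insert, Set.image_insert_eq, Set.mem_union, Set.mem_insert_iff,
      Set.mem_singleton_iff]
    tauto

/-- Adjoining one vector outside the current span raises the dimension by exactly one. -/
theorem exists_span_image_finrank_eq {v : ι → E} {I J : Set ι}
    (hIJ : span ℝ (v '' I) ≤ span ℝ (v '' J)) {m : ℕ} (hI : finrank ℝ (span ℝ (v '' I)) ≤ m)
    (hJ : m ≤ finrank ℝ (span ℝ (v '' J))) :
    ∃ K : Set ι, span ℝ (v '' I) ≤ span ℝ (v '' K) ∧ span ℝ (v '' K) ≤ span ℝ (v '' J) ∧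
      finrank ℝ (span ℝ (v '' K)) = m := by
  induction m, hI using Nat.le_induction with
  | base => exact ⟨I, le_rfl, hIJ, rfl⟩
  | succ m hm ih =>
    obtain ⟨K, hIK, hKJ, hK⟩ := ih (by omega)
    obtain ⟨j, hj, hjK⟩ : ∃ j ∈ J, v j ∉ span ℝ (v '' K) := by
      by_contra! h
      have : span ℝ (v '' J) ≤ span ℝ (v '' K) := span_le.2 (by
        rintro _ ⟨j, hj, rfl⟩
        exact h j hj)
      have := finrank_mono this
      omega
    have hlt : span ℝ (v '' K) < span ℝ (v '' insert j K) :=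
      lt_of_le_of_ne (span_mono (Set.image_mono (Set.subset_insert _ _)))
        fun h => hjK (h ▸ subset_span ⟨j, by simp, rfl⟩)
    refine ⟨insert j K, hIK.trans hlt.le, ?_, le_antisymm ?_ ?_⟩
    · rw [Set.image_insert_eq, span_insert]
      exact sup_le ((span_singleton_le_iff_mem _ _).2 (subset_span ⟨j, hj, rfl⟩)) hKJ
    · rw [Set.image_insert_eq, span_insert]
      have h1 := finrank_add_le_finrank_add_finrank (span ℝ {v j}) (span ℝ (v '' K))
      have h2 := finrank_span_le_card (R := ℝ) ({v j} : Set E)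
      simp at h2
      omega
    · have := finrank_lt_finrank_of_lt hlt
      omega

theorem exists_basis_index {v : ι → E} {I : Set ι} {m : ℕ}
    (hI : finrank ℝ (span ℝ (v '' I)) = m) :
    ∃ a : Fin m → ι, LinearIndependent ℝ (v ∘ a) ∧
      span ℝ (Set.range (v ∘ a)) = span ℝ (v '' I) := by
  subst hI
  obtain ⟨f, hf, hspan, hli⟩ := exists_fun_fin_finrank_span_eq ℝ (v '' I)
  choose a ha hfa using hf
  obtain rfl : v ∘ a = f := funext hfa
  exact ⟨a, hli, hspan⟩

theorem joinedByHyperplane_of_finrank_sup_le {v : ι → E} (hE : finrank ℝ E = 5)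
    (hv : span ℝ (Set.range v) = ⊤) {I J I' J' : Set ι}
    (hI' : finrank ℝ (span ℝ (v '' I')) = 3) (hJ' : finrank ℝ (span ℝ (v '' J')) = 3)
    (hI : span ℝ (v '' I') ≤ span ℝ (v '' I)) (hJ : span ℝ (v '' J') ≤ span ℝ (v '' J))
    (h : finrank ℝ ↥(span ℝ (v '' I') ⊔ span ℝ (v '' J')) ≤ 4) : JoinedByHyperplane v I J := by
  rw [← span_union, ← Set.image_union] at h
  obtain ⟨K, hK, -, hK4⟩ := exists_span_image_finrank_eq (v := v) (I := I' ∪ J')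
    (J := Set.univ) (span_mono (Set.image_mono (Set.subset_univ _))) h
    (by rw [Set.image_univ, hv, finrank_top, hE]; norm_num)
  exact ⟨I', J', K, hI', hJ', hK4, hI, hJ,
    (span_mono (Set.image_mono Set.subset_union_left)).trans hK,
    (span_mono (Set.image_mono Set.subset_union_right)).trans hK⟩

/-- Restoring one omitted basis vector on the `I` side and extending inside `span (v '' J)` on the
other gives two three-dimensional subspaces sharing a plane, so their sum has dimension at most 3 +
3 - 2 = 4. -/
theorem joinedByHyperplane_of_subset {v : ι → E} (hE : finrank ℝ E = 5)
    (hv : span ℝ (Set.range v) = ⊤) {I J : Set ι} (hJ : finrank ℝ (span ℝ (v '' J)) = 4)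
    {a : Fin 4 → ι} (ha : LinearIndependent ℝ (v ∘ a))
    (haI : span ℝ (Set.range (v ∘ a)) = span ℝ (v '' I)) {i j : Fin 4} (hij : i ≠ j)
    (h : span ℝ (v '' (a '' {i, j}ᶜ)) ≤ span ℝ (v '' J)) : JoinedByHyperplane v I J := by
  have h2 : finrank ℝ (span ℝ (v '' (a '' {i, j}ᶜ))) = 2 := by
    have := finrank_span_image_compl ha {i, j}
    rwa [Finset.card_pair hij, Finset.coe_pair] at this
  have h3 : finrank ℝ (span ℝ (v '' (a '' {i}ᶜ))) = 3 := by
    have := finrank_span_image_compl ha {i}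
    rwa [Finset.card_singleton, Finset.coe_singleton] at this
  obtain ⟨J', hJ1, hJ2, hJ3⟩ := exists_span_image_finrank_eq (m := 3) h (by omega) (by omega)
  refine joinedByHyperplane_of_finrank_sup_le hE hv h3 hJ3 ?_ hJ2 ?_
  · rw [← haI, ← Set.image_comp]
    exact span_mono (Set.image_subset_range _ _)
  · have h4 := finrank_sup_add_finrank_inf_eq (span ℝ (v '' (a '' {i}ᶜ))) (span ℝ (v '' J'))
    have h5 : span ℝ (v '' (a '' {i, j}ᶜ)) ≤
        span ℝ (v '' (a '' {i}ᶜ)) ⊓ span ℝ (v '' J') :=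
      le_inf (span_mono (Set.image_mono (Set.image_mono (Set.compl_subset_compl.2 (by simp))))) hJ1
    have := finrank_mono h5
    omega

theorem joinedByHyperplane {v : ι → E} (hE : finrank ℝ E = 5)
    (hv : span ℝ (Set.range v) = ⊤)
    (h4 : ∀ I : Set ι, finrank ℝ (span ℝ (v '' I)) = 3 → ∀ k : Fin 4 → ι,
      ∃ a b, a ≠ b ∧ span ℝ (v '' I) ⊔ span ℝ {v (k a), v (k b)} ≠ ⊤)
    {I J : Set ι} (hI : finrank ℝ (span ℝ (v '' I)) = 4)
    (hJ : finrank ℝ (span ℝ (v '' J)) = 4) : JoinedByHyperplane v I J := by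
  obtain ⟨a, ha, haI⟩ := exists_basis_index hI
  obtain ⟨b, hb, hbJ⟩ := exists_basis_index hJ
  -- Indexing by the disjoint sum counts a generator twice if both bases use it.
  let e : Fin 4 ⊕ Fin 4 → ι := Sum.elim a b
  obtain ⟨s, t, hst, hD⟩ : ∃ s t, s ≠ t ∧ span ℝ ((v ∘ e) '' {s, t}ᶜ) ≠ ⊤ := by
    by_contra! h
    obtain ⟨C, S, hS, hC, hCS⟩ := exists_four_classes_of_span_compl_pair (by simp) hE (v ∘ e) h
    let g := S.equivFinOfCardEq hS
    rw [Set.image_comp] at hC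
    obtain ⟨k, l, hkl, hne⟩ := h4 _ hC fun k => e (g.symm k)
    rw [← Set.image_comp] at hne
    exact hne (hCS _ (g.symm k).2 _ (g.symm l).2 fun h => hkl (g.symm.injective (Subtype.ext h)))
  have hD4 : finrank ℝ (span ℝ ((v ∘ e) '' {s, t}ᶜ)) ≤ 4 := by
    have := finrank_lt hD
    omega
  have hle : ∀ (f : Fin 4 → Fin 4 ⊕ Fin 4) (T : Set (Fin 4)), (∀ x ∈ T, f x ≠ s ∧ f x ≠ t) →
      span ℝ (v '' ((e ∘ f) '' T)) ≤ span ℝ ((v ∘ e) '' {s, t}ᶜ) := by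
    intro f T hT
    rw [← Set.image_comp]
    refine span_mono ?_
    rintro _ ⟨x, hx, rfl⟩
    exact ⟨f x, by simpa using hT x hx, rfl⟩
  -- If one vector is dropped from each basis, the two remaining triples already lie in a common
  -- hyperplane.
  have mixed : ∀ i j, (∀ x, x ≠ i → Sum.inl x ≠ s ∧ Sum.inl x ≠ t) →
      (∀ x, x ≠ j → Sum.inr x ≠ s ∧ Sum.inr x ≠ t) → JoinedByHyperplane v I J := by
    intro i j hi hj
    refine joinedByHyperplane_of_finrank_sup_le hE hv
      (I' := a '' ((({i} : Finset (Fin 4)) : Set (Fin 4))ᶜ))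
      (J' := b '' ((({j} : Finset (Fin 4)) : Set (Fin 4))ᶜ))
      (finrank_span_image_compl ha _) (finrank_span_image_compl hb _) ?_ ?_
      ((finrank_mono (sup_le (hle Sum.inl _ ?_) (hle Sum.inr _ ?_))).trans hD4)
    · rw [← haI, ← Set.image_comp]
      exact span_mono (Set.image_subset_range _ _)
    · rw [← hbJ, ← Set.image_comp]
      exact span_mono (Set.image_subset_range _ _)
    · simpa using hi
    · simpa using hj
  rcases s with i | i <;> rcases t with j | j
  · have hij : i ≠ j := fun h => hst (congrArg _ h)
    -- Both dropped vectors come from `a`, so the hyperplane contains all of `b` and equals `span (v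
    -- '' J)`; it also contains the two remaining vectors of `a`.
    have hJD := hle Sum.inr Set.univ (by simp)
    have heq : span ℝ (v '' J) = span ℝ ((v ∘ e) '' {Sum.inl i, Sum.inl j}ᶜ) := by
      refine eq_of_le_of_finrank_le ?_ (by omega)
      rw [← Set.image_comp, Set.image_univ] at hJD
      exact hbJ.ge.trans hJD
    exact joinedByHyperplane_of_subset hE hv hJ ha haI hij
      (heq ▸ hle Sum.inl _ (by simp))
  · exact mixed i j (by simp) (by simp)
  · exact mixed j i (by simp) (by simp)
  · have hij : i ≠ j := fun h => hst (congrArg _ h)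
    have hID := hle Sum.inl Set.univ (by simp)
    have heq : span ℝ (v '' I) = span ℝ ((v ∘ e) '' {Sum.inr i, Sum.inr j}ᶜ) := by
      refine eq_of_le_of_finrank_le ?_ (by omega)
      rw [← Set.image_comp, Set.image_univ] at hID
      exact haI.ge.trans hID
    exact (joinedByHyperplane_of_subset hE hv hI hb hbJ hij
      (heq ▸ hle Sum.inr _ (by simp))).symm

end Spanned

/-! ### From spanned subspaces to belt paths -/

section Belts

open Module Submodule

variable {E : Type*} [NormedAddCommGroup E] [NormedSpace ℝ E] {n : ℕ} {v : Fin n → E} {c : E}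

theorem IsFacet.exists_vectorSpan_eq {F : Set E} (hF : IsFacet (c +ᵥ zonotope v) F) :
    ∃ I : Set (Fin n), vectorSpan ℝ F = span ℝ (v '' I) := by
  obtain ⟨l, rfl⟩ := hF.2.1 hF.1
  exact ⟨_, vectorSpan_toExposed l hF.1⟩

theorem hasBeltPath_two {P F F' K G G' : Set E} (hF : IsFacet P F) (hF' : IsFacet P F')
    (hK : IsFacet P K) (hG : IsRidge P G) (hG' : IsRidge P G')
    (hGF : vectorSpan ℝ G ≤ vectorSpan ℝ F) (hGK : vectorSpan ℝ G ≤ vectorSpan ℝ K)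
    (hGK' : vectorSpan ℝ G' ≤ vectorSpan ℝ K) (hGF' : vectorSpan ℝ G' ≤ vectorSpan ℝ F') :
    HasBeltPath P 2 F F' := by
  refine ⟨![F, K, F'], ![belt P G, belt P G'], rfl, rfl, ?_, ?_⟩
  · intro i
    fin_cases i
    exacts [hF, hK, hF']
  · intro i
    fin_cases i
    exacts [⟨⟨G, hG, rfl⟩, ⟨hF, hGF⟩, ⟨hK, hGK⟩⟩, ⟨⟨G', hG', rfl⟩, ⟨hK, hGK'⟩, ⟨hF', hGF'⟩⟩]

theorem beltDiameter_le {P : Set E} {m : ℕ}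
    (h : ∀ F F', IsFacet P F → IsFacet P F' → HasBeltPath P m F F') : beltDiameter P ≤ m := by
  refine iSup₂_le fun F hF => iSup₂_le fun F' hF' => ?_
  rw [beltDist]
  split_ifs
  · exact zero_le
  · exact iInf₂_le m (h F F' hF hF')

variable [FiniteDimensional ℝ E]

theorem hasBeltPath_two_of_tilesBy {T : Set E} (hE : finrank ℝ E = 5)
    (hc : IsCompact (c +ᵥ zonotope v)) (hconv : Convex ℝ (c +ᵥ zonotope v))
    (hint : (interior (c +ᵥ zonotope v)).Nonempty) (hT : TilesBy (c +ᵥ zonotope v) T)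
    {F F' : Set E} (hF : IsFacet (c +ᵥ zonotope v) F) (hF' : IsFacet (c +ᵥ zonotope v) F') :
    HasBeltPath (c +ᵥ zonotope v) 2 F F' := by
  have hZ : -c +ᵥ (c +ᵥ zonotope v) = zonotope v := by simp
  have hZc : IsCompact (zonotope v) := hZ ▸ hc.vadd (-c)
  have hZconv : Convex ℝ (zonotope v) := hZ ▸ hconv.vadd (-c)
  have hZint : (interior (zonotope v)).Nonempty := by
    rw [interior_vadd] at hint
    simpa using hint
  have hv : span ℝ (Set.range v) = ⊤ := by
    rw [← vectorSpan_vadd_zonotope (c := c), ← direction_affineSpan,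
      affineSpan_eq_top_of_nonempty_interior, AffineSubspace.direction_top]
    exact hint.mono (interior_mono (subset_convexHull ℝ _))
  have hdimP : dimension (c +ᵥ zonotope v) = 5 := by
    rw [dimension, vectorSpan_vadd_zonotope, hv, finrank_top, hE]
  have h4 : ∀ I : Set (Fin n), finrank ℝ (span ℝ (v '' I)) = 3 → ∀ k : Fin 4 → Fin n,
      ∃ a b, a ≠ b ∧ span ℝ (v '' I) ⊔ span ℝ {v (k a), v (k b)} ≠ ⊤ := fun I hI k =>
    hT.of_vadd.not_four_classes hZc hZconv hZint (by rw [hI, hE]) k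
  obtain ⟨I, hI⟩ := hF.exists_vectorSpan_eq
  obtain ⟨J, hJ⟩ := hF'.exists_vectorSpan_eq
  have hI4 : finrank ℝ (span ℝ (v '' I)) = 4 := by
    have := hF.2.2
    rw [hdimP, dimension, hI] at this
    omega
  have hJ4 : finrank ℝ (span ℝ (v '' J)) = 4 := by
    have := hF'.2.2
    rw [hdimP, dimension, hJ] at this
    omega
  obtain ⟨I', J', K, hI'3, hJ'3, hK4, hI'I, hJ'J, hI'K, hJ'K⟩ :=
    joinedByHyperplane hE hv h4 hI4 hJ4
  obtain ⟨l₁, -, hne₁, hs₁⟩ := exists_toExposed_vectorSpan_eq hc I'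
  obtain ⟨l₂, -, hne₂, hs₂⟩ := exists_toExposed_vectorSpan_eq hc J'
  obtain ⟨l₃, -, hne₃, hs₃⟩ := exists_toExposed_vectorSpan_eq hc K
  refine hasBeltPath_two hF hF' (K := l₃.toExposed _) (G := l₁.toExposed _)
    (G' := l₂.toExposed _) ⟨hne₃, ContinuousLinearMap.toExposed.isExposed, ?_⟩
    ⟨hne₁, ContinuousLinearMap.toExposed.isExposed, ?_⟩
    ⟨hne₂, ContinuousLinearMap.toExposed.isExposed, ?_⟩ ?_ ?_ ?_ ?_
  · rw [hdimP, dimension, hs₃, hK4]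
  · rw [hdimP, dimension, hs₁, hI'3]
  · rw [hdimP, dimension, hs₂, hJ'3]
  · rwa [hs₁, hI]
  · rwa [hs₁, hs₃]
  · rwa [hs₂, hs₃]
  · rwa [hs₂, hJ]

end Belts

end BeltZonotope

theorem mainTheorem3 (P : Set (EuclideanSpace ℝ (Fin 5)))
    (hZ : BeltZonotope.IsZonotope P) (hP : BeltZonotope.IsParallelohedron P) :
    BeltZonotope.beltDiameter P ≤ 2 := by
  obtain ⟨n, v, c, rfl⟩ := hZ
  obtain ⟨⟨S, hS, hPS⟩, hint, T, hT⟩ := hP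
  refine BeltZonotope.beltDiameter_le (m := 2) fun F F' hF hF' =>
    BeltZonotope.hasBeltPath_two_of_tilesBy (by simp) ?_ ?_ hint hT hF hF'
  · rw [hPS]
    exact hS.isCompact_convexHull ℝ
  · rw [hPS]
    exact convex_convexHull ℝ S
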